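/- Let $d\ge 1$ and let $$h(x)=\sum_{i=1}^k \frac{\alpha_i}{(2\pi)^{d/2}\det(\Sigma_i)^{1/2}}\exp\!\Bigl(-\tfrac12(x-\mu_i)^\top\Sigma_i^{-1}(x-\mu_i)\Bigr),\qquad x\in\mathbb{R}^d,$$ be a Gaussian mixture density, where $k\ge 1$, $\alpha_i>0$, $\sum_{i=1}^k\alpha_i=1$, $\mu_i\in\mathbb{R}^d$, and each $\Sigma_i\in\mathbb{R}^{d\times d}$ is symmetric positive definite. Suppose that every critical point of $h$ is nondegenerate, that is, $\det D^2h(x)\neq 0$ whenever $\nabla h(x)=0$. Then $h$ has only finitely many critical points, and if $N$ is the number of critical points of $h$ and $M$ is the number of local maxima of $h$ (points $x$ with $h(y)\le h(x)$ for all $y$ in some neighbourhood of $x$), then $$M\le\left\lfloor\frac{N+1}{2}\right\rfloor .$$ -/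

import Mathlib

open scoped Matrix

noncomputable section

/-- The Gaussian density on `ℝ^d` with mean `μ` and covariance matrix `S`:
`(2π)^{-d/2} det(S)^{-1/2} exp(-(x-μ)ᵀ S⁻¹ (x-μ) / 2)` (meant for positive definite `S`). -/
def gaussianDensity {d : ℕ} (μ : EuclideanSpace ℝ (Fin d)) (S : Matrix (Fin d) (Fin d) ℝ)
    (x : EuclideanSpace ℝ (Fin d)) : ℝ :=
  1 / ((2 * Real.pi) ^ ((d : ℝ) / 2) * Real.sqrt S.det) *
    Real.exp (-(1 / 2) * ((x - μ).ofLp ⬝ᵥ (S⁻¹ *ᵥ (x - μ).ofLp)))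

/-- `h` is a (finite) Gaussian mixture density on `ℝ^d`: `h = ∑ i, α i • φ i` with positive
weights summing to one and Gaussian densities `φ i` with positive definite covariances. -/
def IsGaussianMixtureDensity {d : ℕ} (h : EuclideanSpace ℝ (Fin d) → ℝ) : Prop :=
  ∃ (k : ℕ) (α : Fin k → ℝ) (μ : Fin k → EuclideanSpace ℝ (Fin d))
    (S : Fin k → Matrix (Fin d) (Fin d) ℝ),
    (∀ i, 0 < α i) ∧ ∑ i, α i = 1 ∧ (∀ i, (S i).PosDef) ∧
      ∀ x, h x = ∑ i, α i * gaussianDensity (μ i) (S i) x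

/-- The critical set `{x | ∇h(x) = 0}`. -/
def criticalSet {d : ℕ} (h : EuclideanSpace ℝ (Fin d) → ℝ) : Set (EuclideanSpace ℝ (Fin d)) :=
  {x | gradient h x = 0}

/-- The set of local maxima (modes) of `h`. -/
def modalSet {d : ℕ} (h : EuclideanSpace ℝ (Fin d) → ℝ) : Set (EuclideanSpace ℝ (Fin d)) :=
  {x | ∃ r > 0, ∀ y, ‖y - x‖ < r → h y ≤ h x}

/-- The Hessian matrix of `h` at `x` in the standard coordinates of `ℝ^d`. -/
def hessianMatrix {d : ℕ} (h : EuclideanSpace ℝ (Fin d) → ℝ) (x : EuclideanSpace ℝ (Fin d)) :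
    Matrix (Fin d) (Fin d) ℝ :=
  Matrix.of fun i j =>
    fderiv ℝ (fderiv ℝ h) x (EuclideanSpace.single i 1) (EuclideanSpace.single j 1)

end

/-!
For `f = -h` the claim is the weak Morse inequality `#minima ≤ #(other critical points) + 1`, which
is proved without flows or the Morse lemma.

*Local part.* At a nondegenerate critical point `s` an orthogonal basis for the Hessian gives a
linear involution `R` such that `f` decreases at `s + x` in the direction `R x` for all small
`x ≠ 0` (`exists_isDescentInvolution`). In particular `s` is isolated among the critical points.
Writing `x = u + v` with `R u = -u` and `R v = v`, the hyperbola `s + e⁻ᵗ u + eᵗ v` stays in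
`{f < f s}` if it starts there, and leads to a point close to a sphere of fixed vectors. Of any three
points of a sphere some two are not antipodal, hence `{f < f s}` has at most two branches at `s`
(`IsDescentInvolution.exists_joinedIn_or`).

*Global part.* For `c < 0` the set `{f ≤ c}` is compact, so each branch leads to a minimum. This
makes the minima the vertices of a graph with one edge for each critical point that is not a
minimum. If the graph were disconnected, its minima would split into two classes `A` and `B`. At the
infimum `c` of the levels at which `A` and `B` get joined, one step of gradient descent moves a
joining path from slightly above `c` into `{f < c}` together with small balls around the critical
points of level `c`; since no critical point separates the classes, this set falls apart into an
open part for `A` and one for `B`, a contradiction (`false_of_separated_minima`). A connected graph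
has at most one more vertex than edges (`ncard_isLocalMin_le`).

*Gaussian mixtures.* A mixture density is smooth and positive, it tends to zero at infinity, and
its radial derivative is negative far from the origin, so its critical set is compact;
being discrete by the local part, it is finite.
-/

open Set Filter Topology

/-! ### Local structure at a nondegenerate critical point -/

section LocalStructure

variable {E : Type*} [NormedAddCommGroup E] [NormedSpace ℝ E]

/-- A positive definite form on a finite-dimensional space is coercive. -/
theorem exists_pos_mul_sq_norm_le [FiniteDimensional ℝ E] (B : E →L[ℝ] E →L[ℝ] ℝ)
    (hB : ∀ x, x ≠ 0 → 0 < B x x) : ∃ m > 0, ∀ x, m * ‖x‖ ^ 2 ≤ B x x := by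
  have hcont : Continuous fun x => B x x := by fun_prop
  rcases (Metric.sphere (0 : E) 1).eq_empty_or_nonempty with he | hne
  · refine ⟨1, one_pos, fun x => ?_⟩
    have hx : x = 0 := by
      by_contra hx
      have : (‖x‖⁻¹ • x) ∈ Metric.sphere (0 : E) 1 := by
        simp [norm_smul, hx]
      rw [he] at this
      exact this
    simp [hx]
  · obtain ⟨z, hz, hmin⟩ := (isCompact_sphere (0 : E) 1).exists_isMinOn hne hcont.continuousOn
    have hz0 : z ≠ 0 := by
      rintro rfl
      simp at hz
    refine ⟨B z z, hB z hz0, fun x => ?_⟩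
    by_cases hx : x = 0
    · simp [hx]
    have hn : 0 < ‖x‖ := norm_pos_iff.mpr hx
    have hs : (‖x‖⁻¹ • x) ∈ Metric.sphere (0 : E) 1 := by
      simp [norm_smul, hx]
    have h1 : B z z ≤ B (‖x‖⁻¹ • x) (‖x‖⁻¹ • x) := hmin hs
    simp only [map_smul, smul_apply, smul_eq_mul] at h1
    have h2 : B x x = (‖x‖⁻¹ * (‖x‖⁻¹ * B x x)) * ‖x‖ ^ 2 := by field_simp
    rw [h2]
    exact mul_le_mul_of_nonneg_right h1 (by positivity)

/-- A linear involution adapted to a nondegenerate symmetric form: in an orthogonal basis it is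
minus the sign of the form on each basis vector. -/
theorem exists_involution_apply_self_neg [FiniteDimensional ℝ E] (B : E →L[ℝ] E →L[ℝ] ℝ)
    (hsymm : ∀ x y, B x y = B y x) (hnd : ∀ x, (∀ y, B x y = 0) → x = 0) :
    ∃ R : E →L[ℝ] E, (∀ x, R (R x) = x) ∧ ∀ x, x ≠ 0 → B x (R x) < 0 := by
  let B' : LinearMap.BilinForm ℝ E := LinearMap.mk₂ ℝ (fun x y => B x y)
    (by simp) (by simp) (by simp) (by simp)
  obtain ⟨v, hv⟩ := LinearMap.BilinForm.exists_orthogonal_basis (B := B')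
    ⟨fun x y => hsymm x y⟩
  have hsep : B'.SeparatingLeft := fun x hx => hnd x hx
  have hdiag : ∀ i, B (v i) (v i) ≠ 0 := fun i =>
    hv.not_isOrtho_basis_self_of_separatingLeft hsep i
  have horth : ∀ i j, i ≠ j → B (v i) (v j) = 0 := fun i j hij => hv hij
  let σ : Fin (Module.finrank ℝ E) → ℝ := fun i => -SignType.sign (B (v i) (v i))
  have hσ : ∀ i, σ i * σ i = 1 := by
    intro i
    rcases lt_or_gt_of_ne (hdiag i) with h | h <;> simp [σ, h]
  have hσB : ∀ i, σ i * B (v i) (v i) < 0 := by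
    intro i
    rcases lt_or_gt_of_ne (hdiag i) with h | h <;> simp [σ, h]
  let R₀ : E →ₗ[ℝ] E := v.constr ℝ fun i => σ i • v i
  have hRv : ∀ i, R₀ (v i) = σ i • v i := fun i => v.constr_basis ℝ _ i
  have hRR : R₀ ∘ₗ R₀ = LinearMap.id := by
    refine v.ext fun i => ?_
    simp [hRv, smul_smul, hσ]
  refine ⟨LinearMap.toContinuousLinearMap R₀, fun x => LinearMap.congr_fun hRR x, fun x hx => ?_⟩
  obtain ⟨c, rfl⟩ : ∃ c : Fin (Module.finrank ℝ E) → ℝ, x = ∑ i, c i • v i :=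
    ⟨_, (v.sum_repr x).symm⟩
  have hRx : R₀ (∑ i, c i • v i) = ∑ i, (c i * σ i) • v i := by
    simp [map_sum, hRv, smul_smul]
  have hval : B (∑ i, c i • v i) (R₀ (∑ i, c i • v i)) =
      ∑ i, c i ^ 2 * (σ i * B (v i) (v i)) := by
    rw [hRx]
    simp only [map_sum, map_smul, sum_apply, smul_apply, smul_eq_mul]
    refine Finset.sum_congr rfl fun i _ => ?_
    rw [Finset.sum_eq_single i]
    · ring
    · intro j _ hj
      simp [horth j i hj]
    · simp
  change B (∑ i, c i • v i) (R₀ (∑ i, c i • v i)) < 0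
  rw [hval]
  have hex : ∃ i, c i ≠ 0 := by
    by_contra! hall
    exact hx (by simp [hall])
  obtain ⟨i, hi⟩ := hex
  refine Finset.sum_neg' (fun j _ => ?_) ⟨i, Finset.mem_univ i, ?_⟩
  · exact mul_nonpos_of_nonneg_of_nonpos (sq_nonneg _) (hσB j).le
  · exact mul_neg_of_pos_of_neg (by positivity) (hσB i)

/-- The mean value theorem along the segment from `s` to `s + w`. -/
theorem exists_add_sub_eq_fderiv_apply {f : E → ℝ} (hf : Differentiable ℝ f) (s w : E) :
    ∃ t ∈ Ioo (0 : ℝ) 1, f (s + w) - f s = fderiv ℝ f (s + t • w) w := by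
  have hd : ∀ t : ℝ, HasDerivAt (fun t : ℝ => f (s + t • w)) (fderiv ℝ f (s + t • w) w) t := by
    intro t
    have h1 : HasDerivAt (fun t : ℝ => s + t • w) w t := by
      simpa using ((hasDerivAt_id t).smul_const w).const_add s
    exact (hf _).hasFDerivAt.comp_hasDerivAt t h1
  obtain ⟨t, ht, h⟩ := exists_hasDerivAt_eq_slope (fun t : ℝ => f (s + t • w)) _ zero_lt_one
    (fun t _ => (hd t).continuousAt.continuousWithinAt) (fun t _ => hd t)
  exact ⟨t, ht, by simpa using h.symm⟩

/-- A linear involution `R` such that `f` decreases at `s + x` in the direction `R x` for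
`0 < ‖x‖ ≤ ρ`. Its fixed vectors are descent directions and its anti-fixed vectors are ascent
directions; it plays the role of a Morse chart at the critical point `s`. -/
structure IsDescentInvolution (f : E → ℝ) (s : E) (R : E →L[ℝ] E) (ρ : ℝ) : Prop where
  radius_pos : 0 < ρ
  involutive : ∀ x, R (R x) = x
  fderiv_neg : ∀ x, x ≠ 0 → ‖x‖ ≤ ρ → fderiv ℝ f (s + x) (R x) < 0

/-- At a nondegenerate critical point, the involution adapted to the Hessian works in a small ball,
since the derivative of `f` agrees with the Hessian to first order. -/
theorem exists_isDescentInvolution [FiniteDimensional ℝ E] {f : E → ℝ} (hf : ContDiff ℝ 2 f)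
    {s : E} (hs : fderiv ℝ f s = 0)
    (hnd : ∀ x, (∀ y, fderiv ℝ (fderiv ℝ f) s x y = 0) → x = 0) :
    ∃ R ρ, IsDescentInvolution f s R ρ := by
  set B := fderiv ℝ (fderiv ℝ f) s with hBdef
  have hsymm : ∀ x y, B x y = B y x := fun x y =>
    (hf.contDiffAt.isSymmSndFDerivAt (by simp)) x y
  obtain ⟨R, hRR, hneg⟩ := exists_involution_apply_self_neg B hsymm hnd
  obtain ⟨m, hm, hmB⟩ := exists_pos_mul_sq_norm_le
    (-((ContinuousLinearMap.compL ℝ E E ℝ).flip R ∘L B)) (fun x hx => by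
      simpa using hneg x hx)
  have hmB' : ∀ x, B x (R x) ≤ -(m * ‖x‖ ^ 2) := fun x => by
    have := hmB x
    simp only [neg_apply, ContinuousLinearMap.comp_apply,
      ContinuousLinearMap.flip_apply, ContinuousLinearMap.compL_apply] at this
    linarith
  have hdiff : HasFDerivAt (fderiv ℝ f) B s :=
    ((hf.fderiv_right (m := 1) (by norm_num)).differentiable (by norm_num) s).hasFDerivAt
  have ho := (hasFDerivAt_iff_isLittleO_nhds_zero.mp hdiff).def
    (show 0 < m / (2 * (‖R‖ + 1)) by positivity)
  obtain ⟨ρ, hρ, hball⟩ := Metric.eventually_nhds_iff.mp ho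
  refine ⟨R, ρ / 2, by positivity, hRR, fun x hx hxρ => ?_⟩
  have hb := hball (y := x) (by rw [dist_zero_right]; linarith)
  rw [hs, sub_zero] at hb
  have hxn : 0 < ‖x‖ := norm_pos_iff.mpr hx
  have h1 : (fderiv ℝ f (s + x) - B x) (R x) ≤ m / 2 * ‖x‖ ^ 2 := by
    calc (fderiv ℝ f (s + x) - B x) (R x) ≤ ‖(fderiv ℝ f (s + x) - B x) (R x)‖ := le_abs_self _
      _ ≤ ‖fderiv ℝ f (s + x) - B x‖ * ‖R x‖ := ContinuousLinearMap.le_opNorm _ _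
      _ ≤ (m / (2 * (‖R‖ + 1)) * ‖x‖) * ((‖R‖ + 1) * ‖x‖) := by
          gcongr
          exact (R.le_opNorm x).trans (by gcongr; linarith)
      _ = m / 2 * ‖x‖ ^ 2 := by
          field_simp
  rw [sub_apply] at h1
  have h2 := hmB' x
  have h3 : 0 < m * ‖x‖ ^ 2 := by positivity
  linarith

namespace IsDescentInvolution

variable {f : E → ℝ} {s : E} {R : E →L[ℝ] E} {ρ : ℝ}

theorem fderiv_ne_zero (h : IsDescentInvolution f s R ρ) {x : E} (hx : x ≠ s)
    (hxρ : ‖x - s‖ ≤ ρ) : fderiv ℝ f x ≠ 0 := by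
  intro h0
  have := h.fderiv_neg (x - s) (sub_ne_zero.mpr hx) hxρ
  simp [h0] at this

theorem apply_add_lt (h : IsDescentInvolution f s R ρ) (hf : Differentiable ℝ f) {v : E}
    (hv : R v = v) (hv0 : v ≠ 0) (hvρ : ‖v‖ ≤ ρ) : f (s + v) < f s := by
  obtain ⟨t, ht, heq⟩ := exists_add_sub_eq_fderiv_apply hf s v
  have h1 := h.fderiv_neg (t • v) (smul_ne_zero ht.1.ne' hv0) (by
    rw [norm_smul, Real.norm_of_nonneg ht.1.le]
    nlinarith [ht.2, norm_nonneg v])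
  rw [map_smul, hv, map_smul, smul_eq_mul] at h1
  have := neg_of_mul_neg_right h1 ht.1.le
  linarith

theorem lt_apply_add (h : IsDescentInvolution f s R ρ) (hf : Differentiable ℝ f) {u : E}
    (hu : R u = -u) (hu0 : u ≠ 0) (huρ : ‖u‖ ≤ ρ) : f s < f (s + u) := by
  obtain ⟨t, ht, heq⟩ := exists_add_sub_eq_fderiv_apply hf s u
  have h1 := h.fderiv_neg (t • u) (smul_ne_zero ht.1.ne' hu0) (by
    rw [norm_smul, Real.norm_of_nonneg ht.1.le]
    nlinarith [ht.2, norm_nonneg u])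
  rw [map_smul, hu, map_smul, smul_eq_mul, map_neg] at h1
  have := neg_of_mul_neg_right h1 ht.1.le
  linarith

/-- `f` does not increase along the hyperbolic curve `t ↦ s + e⁻ᵗ u + eᵗ v`, which solves
`x' = R (x - s)`. -/
theorem apply_hyperbola_le (h : IsDescentInvolution f s R ρ) (hf : Differentiable ℝ f) {u v : E}
    (hu : R u = -u) (hv : R v = v) {T : ℝ}
    (hT : ∀ t ∈ Icc 0 T, ‖Real.exp (-t) • u + Real.exp t • v‖ ≤ ρ) {t : ℝ} (ht : t ∈ Icc 0 T) :
    f (s + (Real.exp (-t) • u + Real.exp t • v)) ≤ f (s + (u + v)) := by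
  have hd : ∀ t : ℝ, HasDerivAt (fun t : ℝ => f (s + (Real.exp (-t) • u + Real.exp t • v)))
      (fderiv ℝ f (s + (Real.exp (-t) • u + Real.exp t • v))
        (R (Real.exp (-t) • u + Real.exp t • v))) t := by
    intro t
    have h1 : HasDerivAt (fun t : ℝ => s + (Real.exp (-t) • u + Real.exp t • v))
        (R (Real.exp (-t) • u + Real.exp t • v)) t := by
      have h2 : HasDerivAt (fun t : ℝ => Real.exp (-t)) (-Real.exp (-t)) t := by
        simpa using (hasDerivAt_neg t).exp
      have h3 := ((h2.smul_const u).add ((Real.hasDerivAt_exp t).smul_const v)).const_add s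
      rw [map_add, map_smul, map_smul, hu, hv, smul_neg, ← neg_smul]
      exact h3
    exact (hf _).hasFDerivAt.comp_hasDerivAt t h1
  have hanti : AntitoneOn (fun t : ℝ => f (s + (Real.exp (-t) • u + Real.exp t • v)))
      (Icc 0 T) := by
    refine antitoneOn_of_deriv_nonpos (convex_Icc 0 T)
      (fun t _ => (hd t).continuousAt.continuousWithinAt)
      (fun t _ => (hd t).differentiableAt.differentiableWithinAt) fun t ht => ?_
    rw [interior_Icc] at ht
    rw [(hd t).deriv]
    by_cases h0 : Real.exp (-t) • u + Real.exp t • v = 0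
    · simp [h0]
    · exact (h.fderiv_neg _ h0 (hT t ⟨ht.1.le, ht.2.le⟩)).le
  have := hanti (left_mem_Icc.mpr (ht.1.trans ht.2)) ht ht.1
  simpa using this

/-- Every point below the critical level and near `s` descends, inside the open sublevel set, to a
fixed vector of `R` of norm `ρ / 2`. -/
theorem exists_joinedIn_fixed [FiniteDimensional ℝ E] (h : IsDescentInvolution f s R ρ)
    (hf : Differentiable ℝ f) :
    ∃ r > 0, ∀ x ∈ Metric.ball s r, f x < f s →
      ∃ v, R v = v ∧ ‖v‖ = ρ / 2 ∧ JoinedIn {y | f y < f s} x (s + v) := by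
  have hρ := h.radius_pos
  set δ := ρ / 2 with hδ
  have hδ0 : 0 < δ := by positivity
  have hcompact : IsCompact {v : E | R v = v ∧ ‖v‖ = δ} := by
    refine (isCompact_sphere (0 : E) δ).of_isClosed_subset ?_ fun v hv => by simpa using hv.2
    exact (isClosed_eq R.continuous continuous_id).inter
      (isClosed_eq continuous_norm continuous_const)
  have hopen : IsOpen {v : E | f (s + v) < f s} :=
    isOpen_lt (hf.continuous.comp (by fun_prop)) continuous_const
  obtain ⟨η, hη, hthick⟩ := hcompact.exists_thickening_subset_open hopen fun v hv =>
    h.apply_add_lt hf hv.1 (norm_pos_iff.mp (hv.2 ▸ hδ0)) (by rw [hv.2, hδ]; linarith)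
  -- Points over the sphere of fixed vectors with a small anti-fixed part are below the level.
  have hbelow : ∀ u v, R v = v → ‖v‖ = δ → ‖u‖ < η → f (s + (u + v)) < f s := by
    intro u v hv hvn hu
    have : u + v ∈ Metric.thickening η {v : E | R v = v ∧ ‖v‖ = δ} :=
      Metric.mem_thickening_iff.mpr ⟨v, ⟨hv, hvn⟩, by simpa [dist_eq_norm] using hu⟩
    exact hthick this
  refine ⟨min η δ / (1 + ‖R‖), by positivity, fun x hx hxs => ?_⟩
  set y := x - s with hy
  have hyn : (1 + ‖R‖) * ‖y‖ < min η δ := by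
    rw [mem_ball_iff_norm, lt_div_iff₀ (by positivity)] at hx
    rw [mul_comm]
    exact hx
  have hRy : ‖R y‖ ≤ ‖R‖ * ‖y‖ := R.le_opNorm y
  set u := (1 / 2 : ℝ) • (y - R y) with hu
  set v := (1 / 2 : ℝ) • (y + R y) with hv
  have huv : u + v = y := by
    rw [hu, hv, ← smul_add]
    rw [show y - R y + (y + R y) = (2 : ℝ) • y by rw [two_smul]; abel, smul_smul]
    norm_num
  have hRu : R u = -u := by
    rw [hu, map_smul, map_sub, h.involutive, ← smul_neg, neg_sub]
  have hRv : R v = v := by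
    rw [hv, map_smul, map_add, h.involutive, add_comm]
  have hun : ‖u‖ < min η δ := by
    have : ‖u‖ ≤ 1 / 2 * (‖y‖ + ‖R y‖) := by
      rw [hu, norm_smul, Real.norm_of_nonneg (by norm_num)]
      gcongr
      exact norm_sub_le _ _
    nlinarith [norm_nonneg y, norm_nonneg R, mul_nonneg (norm_nonneg R) (norm_nonneg y)]
  have hvn : ‖v‖ < min η δ := by
    have : ‖v‖ ≤ 1 / 2 * (‖y‖ + ‖R y‖) := by
      rw [hv, norm_smul, Real.norm_of_nonneg (by norm_num)]
      gcongr
      exact norm_add_le _ _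
    nlinarith [norm_nonneg y, norm_nonneg R, mul_nonneg (norm_nonneg R) (norm_nonneg y)]
  clear_value u v
  have huη : ‖u‖ < η := hun.trans_le (min_le_left _ _)
  have huδ : ‖u‖ < δ := hun.trans_le (min_le_right _ _)
  have hvδ : ‖v‖ < δ := hvn.trans_le (min_le_right _ _)
  have hxy : x = s + (u + v) := by rw [huv, hy]; abel
  have hv0 : v ≠ 0 := by
    intro hv0
    rw [hxy, hv0, add_zero] at hxs
    by_cases hu0 : u = 0
    · simp [hu0] at hxs
    · exact absurd (h.lt_apply_add hf hRu hu0 (by linarith)) hxs.not_gt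
  have hvpos : 0 < ‖v‖ := norm_pos_iff.mpr hv0
  set T := Real.log (δ / ‖v‖) with hTdef
  have hexpT : Real.exp T = δ / ‖v‖ := Real.exp_log (by positivity)
  have hT0 : 0 ≤ T := Real.log_nonneg (by rw [le_div_iff₀ hvpos]; linarith)
  have hvT : ‖Real.exp T • v‖ = δ := by
    rw [norm_smul, Real.norm_of_nonneg (Real.exp_pos _).le, hexpT]
    field_simp
  have huT : ∀ t, 0 ≤ t → ‖Real.exp (-t) • u‖ ≤ ‖u‖ := by
    intro t ht
    rw [norm_smul, Real.norm_of_nonneg (Real.exp_pos _).le]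
    exact mul_le_of_le_one_left (norm_nonneg _) (Real.exp_le_one_iff.mpr (by linarith))
  have hcurve : ∀ t ∈ Icc 0 T, ‖Real.exp (-t) • u + Real.exp t • v‖ ≤ ρ := by
    intro t ht
    have h1 : ‖Real.exp t • v‖ ≤ δ := by
      rw [← hvT, norm_smul, norm_smul, Real.norm_of_nonneg (Real.exp_pos _).le,
        Real.norm_of_nonneg (Real.exp_pos _).le]
      gcongr
      exact ht.2
    have h2 := norm_add_le (Real.exp (-t) • u) (Real.exp t • v)
    have h3 := huT t ht.1
    linarith
  have hRvT : R (Real.exp T • v) = Real.exp T • v := by rw [map_smul, hRv]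
  refine ⟨Real.exp T • v, hRvT, hvT, ?_⟩
  have hj1 : JoinedIn {y | f y < f s} x (s + (Real.exp (-T) • u + Real.exp T • v)) := by
    refine JoinedIn.ofLine
      (f := fun t : ℝ => s + (Real.exp (-(t * T)) • u + Real.exp (t * T) • v))
      (by fun_prop) (by simp [hxy]) (by simp) ?_
    rintro _ ⟨t, ht, rfl⟩
    have htT : t * T ∈ Icc 0 T := ⟨mul_nonneg ht.1 hT0, mul_le_of_le_one_left hT0 ht.2⟩
    exact (h.apply_hyperbola_le hf hRu hRv hcurve htT).trans_lt (hxy ▸ hxs)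
  refine hj1.trans (JoinedIn.ofLine
    (f := fun t : ℝ => s + ((1 - t) • Real.exp (-T) • u + Real.exp T • v))
    (by fun_prop) (by simp) (by simp) ?_)
  rintro _ ⟨t, ht, rfl⟩
  refine hbelow _ _ hRvT hvT ?_
  calc ‖(1 - t) • Real.exp (-T) • u‖ = (1 - t) * ‖Real.exp (-T) • u‖ := by
        rw [norm_smul, Real.norm_of_nonneg (by linarith [ht.2])]
    _ ≤ 1 * ‖u‖ := by
        gcongr
        · linarith [ht.1]
        · exact huT T hT0
    _ < η := by linarith

/-- Two fixed vectors of the same norm that are not antipodal are joined by a segment of nonzero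
fixed vectors, along which `f` stays below the critical level. -/
theorem joinedIn_of_ne_neg (h : IsDescentInvolution f s R ρ) (hf : Differentiable ℝ f) {v w : E}
    (hv : R v = v) (hw : R w = w) (hvn : ‖v‖ = ρ / 2) (hwn : ‖w‖ = ρ / 2) (hne : v ≠ -w) :
    JoinedIn {y | f y < f s} (s + v) (s + w) := by
  have hρ := h.radius_pos
  refine JoinedIn.ofLine (f := fun t : ℝ => s + ((1 - t) • v + t • w))
    (by fun_prop) (by simp) (by simp) ?_
  rintro _ ⟨t, ht, rfl⟩
  have h1t : 0 ≤ 1 - t := by linarith [ht.2]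
  refine h.apply_add_lt hf (by simp [hv, hw]) (fun h0 => ?_) ?_
  · -- equal norms force the weights `1 - t` and `t` to agree
    have h1 : (1 - t) • v = -(t • w) := eq_neg_of_add_eq_zero_left h0
    have h2 := congrArg norm h1
    rw [norm_neg, norm_smul, norm_smul, hvn, hwn, Real.norm_of_nonneg h1t,
      Real.norm_of_nonneg ht.1] at h2
    have h3 : 1 - t = t := mul_right_cancel₀ (by positivity) h2
    rw [h3, ← smul_neg] at h1
    exact hne (smul_right_injective E (by intro h4; linarith) h1)
  · calc ‖(1 - t) • v + t • w‖ ≤ ‖(1 - t) • v‖ + ‖t • w‖ := norm_add_le _ _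
      _ = ρ / 2 := by
          rw [norm_smul, norm_smul, hvn, hwn, Real.norm_of_nonneg h1t, Real.norm_of_nonneg ht.1]
          ring
      _ ≤ ρ := by linarith

/-- The sublevel set below a nondegenerate critical point has at most two branches there: among
three nearby points of it, two lie in the same path component. -/
theorem exists_joinedIn_or [FiniteDimensional ℝ E] (h : IsDescentInvolution f s R ρ)
    (hf : Differentiable ℝ f) :
    ∃ r > 0, ∀ x ∈ Metric.ball s r, ∀ y ∈ Metric.ball s r, ∀ z ∈ Metric.ball s r,
      f x < f s → f y < f s → f z < f s →
      JoinedIn {w | f w < f s} x y ∨ JoinedIn {w | f w < f s} x z ∨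
        JoinedIn {w | f w < f s} y z := by
  obtain ⟨r, hr, hball⟩ := h.exists_joinedIn_fixed hf
  refine ⟨r, hr, fun x hx y hy z hz hxs hys hzs => ?_⟩
  obtain ⟨u, hu, hun, hju⟩ := hball x hx hxs
  obtain ⟨v, hv, hvn, hjv⟩ := hball y hy hys
  obtain ⟨w, hw, hwn, hjw⟩ := hball z hz hzs
  by_cases huv : u = -v
  · by_cases huw : u = -w
    · -- then `v = w`, which is not antipodal to itself
      have hvw : v = w := neg_injective (huv.symm.trans huw)
      subst hvw
      exact Or.inr (Or.inr (hjv.trans hjw.symm))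
    · exact Or.inr (Or.inl ((hju.trans (h.joinedIn_of_ne_neg hf hu hw hun hwn huw)).trans
        hjw.symm))
  · exact Or.inl ((hju.trans (h.joinedIn_of_ne_neg hf hu hv hun hvn huv)).trans hjv.symm)

end IsDescentInvolution

end LocalStructure

/-! ### Path components of sublevel sets -/

section Sublevel

variable {X : Type*} [TopologicalSpace X] {f : X → ℝ}

/-- A path is compact, so `f` attains its maximum along it. -/
theorem JoinedIn.exists_lt_sublevel (hf : Continuous f) {c : ℝ} {a b : X}
    (h : JoinedIn {x | f x < c} a b) : ∃ c' < c, JoinedIn {x | f x < c'} a b := by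
  obtain ⟨γ, hγ⟩ := h
  obtain ⟨t, -, ht⟩ := isCompact_univ.exists_isMaxOn univ_nonempty
    (hf.comp γ.continuous).continuousOn
  have htc : f (γ t) < c := hγ t
  refine ⟨(f (γ t) + c) / 2, by linarith, γ, fun u => ?_⟩
  have : f (γ u) ≤ f (γ t) := ht (mem_univ u)
  change f (γ u) < _
  linarith

/-- Every path component of an open sublevel set with compact closed sublevel set contains a local
minimum. -/
theorem exists_isLocalMin_joinedIn [LocallyPathConnectedSpace X] (hf : Continuous f) {c : ℝ}
    (hc : IsCompact {x | f x ≤ c}) {x : X} (hx : f x < c) :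
    ∃ m, IsLocalMin f m ∧ JoinedIn {y | f y < c} x m := by
  have hopen : IsOpen {y | f y < c} := isOpen_lt hf continuous_const
  set P := pathComponentIn {y | f y < c} x with hP
  have hPopen : IsOpen P := hopen.pathComponentIn x
  have hxP : x ∈ P := mem_pathComponentIn_self hx
  have hcl : closure P ⊆ {y | f y ≤ c} :=
    closure_minimal (fun y (hy : JoinedIn {y | f y < c} x y) => le_of_lt (α := ℝ) hy.target_mem)
      (isClosed_le hf continuous_const)
  obtain ⟨m, hm, hmin⟩ := (hc.of_isClosed_subset isClosed_closure hcl).exists_isMinOn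
    ⟨x, subset_closure hxP⟩ hf.continuousOn
  have hmc : f m < c := (hmin (subset_closure hxP)).trans_lt hx
  -- the minimum over the closure is below the level `c`, so it lies in the component itself
  obtain ⟨y, hym, hyP⟩ := mem_closure_iff.mp hm _ (hopen.pathComponentIn m)
    (mem_pathComponentIn_self hmc)
  have hxm : JoinedIn {y | f y < c} x m := JoinedIn.trans hyP (JoinedIn.symm hym)
  refine ⟨m, ?_, hxm⟩
  filter_upwards [hPopen.mem_nhds hxm] with z hz
  exact hmin (subset_closure hz)

end Sublevel

/-! ### Counting minima -/

section Counting

variable {E : Type*} [NormedAddCommGroup E] [InnerProductSpace ℝ E] [FiniteDimensional ℝ E]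
  {f : E → ℝ}

open scoped RealInnerProductSpace in
/-- One step of gradient descent, short enough to work on a given compact set: it fixes the
critical points and lowers `f` at every other point of the compact set. -/
theorem exists_descent_map (hf : ContDiff ℝ 2 f) {K : Set E} (hK : IsCompact K) :
    ∃ φ : E → E, Continuous φ ∧ (∀ x, fderiv ℝ f x = 0 → φ x = x) ∧
      ∀ x ∈ K, fderiv ℝ f x ≠ 0 → f (φ x) < f x := by
  set g : E → E := fun x => (InnerProductSpace.toDual ℝ E).symm (fderiv ℝ f x) with hg
  have hgf : ∀ x v, ⟪g x, v⟫ = fderiv ℝ f x v := fun x v => by simp [hg]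
  have hgC : ContDiff ℝ 1 g :=
    (InnerProductSpace.toDual ℝ E).symm.contDiff.comp (hf.fderiv_right (by norm_num))
  obtain ⟨r, hr⟩ := hK.isBounded.subset_closedBall 0
  obtain ⟨G, hG⟩ := hK.exists_bound_of_continuousOn hgC.continuous.continuousOn
  obtain ⟨C, hC⟩ := (hgC.locallyLipschitz.locallyLipschitzOn
    (s := Metric.closedBall (0 : E) (r + G))).exists_lipschitzOnWith_of_compact
      (isCompact_closedBall _ _)
  have hC0 : (0 : ℝ) ≤ C := C.2
  set t : ℝ := 1 / (C + 1) with ht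
  have ht0 : 0 < t := by positivity
  have ht1 : t ≤ 1 := by rw [ht, div_le_one (by positivity)]; linarith
  have hCt : C * t < 1 := by rw [ht, mul_one_div, div_lt_one (by positivity)]; linarith
  refine ⟨fun x => x + -(t • g x), by have := hgC.continuous; fun_prop,
    fun x hx => by simp [hg, hx], fun x hx hx0 => ?_⟩
  have hgx : 0 < ‖g x‖ := by
    rw [norm_pos_iff]
    exact fun h0 => hx0 ((LinearIsometryEquiv.map_eq_zero_iff _).mp h0)
  obtain ⟨τ, hτ, heq⟩ := exists_add_sub_eq_fderiv_apply (hf.differentiable (by norm_num)) x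
    (-(t • g x))
  set y := x + τ • -(t • g x) with hy
  have hyx : ‖y - x‖ ≤ t * ‖g x‖ := by
    rw [hy, add_sub_cancel_left, norm_smul, norm_neg, norm_smul, Real.norm_of_nonneg hτ.1.le,
      Real.norm_of_nonneg ht0.le]
    exact mul_le_of_le_one_left (by positivity) hτ.2.le
  have hxr : ‖x‖ ≤ r := by simpa using hr hx
  have hGx := hG x hx
  have hxB : x ∈ Metric.closedBall (0 : E) (r + G) := by
    rw [mem_closedBall_zero_iff]
    linarith
  have hyB : y ∈ Metric.closedBall (0 : E) (r + G) := by
    rw [mem_closedBall_zero_iff]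
    have h1 : ‖y‖ ≤ ‖x‖ + ‖y - x‖ := norm_le_insert' y x
    have h2 : t * ‖g x‖ ≤ ‖g x‖ := mul_le_of_le_one_left hgx.le ht1
    linarith
  have hlip : ‖g y - g x‖ ≤ C * ‖y - x‖ := by
    simpa [dist_eq_norm] using hC.dist_le_mul y hyB x hxB
  have hpos : 0 < ⟪g y, g x⟫ := by
    have h1 : ⟪g y, g x⟫ = ‖g x‖ ^ 2 + ⟪g y - g x, g x⟫ := by
      rw [inner_sub_left, real_inner_self_eq_norm_sq]; ring
    have h2 : -(‖g y - g x‖ * ‖g x‖) ≤ ⟪g y - g x, g x⟫ :=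
      (abs_le.mp (abs_real_inner_le_norm _ _)).1
    have h3 : ‖g y - g x‖ * ‖g x‖ ≤ C * t * ‖g x‖ ^ 2 := by
      calc ‖g y - g x‖ * ‖g x‖ ≤ (C * (t * ‖g x‖)) * ‖g x‖ := by
            gcongr
            exact hlip.trans (by gcongr)
        _ = C * t * ‖g x‖ ^ 2 := by ring
    have h4 : 0 < ‖g x‖ ^ 2 := by positivity
    nlinarith
  rw [map_neg, map_smul, ← hgf, smul_eq_mul] at heq
  change f (x + -(t • g x)) < f x
  have := mul_pos ht0 hpos
  linarith

/-- The minima cannot be split into two nonempty classes `A` and `B` in such a way that, near every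
other critical point, the open sublevel set below it only leads to minima of one class. At the
infimum `c` of the levels at which `A` and `B` get connected, a descent step pushes a connecting
path from slightly above `c` into the union of `{f < c}` and small balls around the critical
points of level `c`, and this union splits into two disjoint open sets. -/
theorem false_of_separated_minima (hf : ContDiff ℝ 2 f) {L : ℝ} (hL : ∀ x, f x < L)
    (hcpt : ∀ c < L, IsCompact {x | f x ≤ c}) (hfin : {x | fderiv ℝ f x = 0}.Finite)
    {A B : Set E} (hA : A.Nonempty) (hB : B.Nonempty) (hdisj : Disjoint A B)
    (hAB : ∀ x, IsLocalMin f x ↔ x ∈ A ∨ x ∈ B)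
    (hsep : ∀ s, fderiv ℝ f s = 0 → ¬ IsLocalMin f s → ∃ r > 0,
      (∀ x ∈ Metric.ball s r, f x < f s → ∃ a ∈ A, JoinedIn {y | f y < f s} a x) ∨
      (∀ x ∈ Metric.ball s r, f x < f s → ∃ b ∈ B, JoinedIn {y | f y < f s} b x)) :
    False := by
  have hfc : Continuous f := hf.continuous
  have hAcrit : ∀ a ∈ A, fderiv ℝ f a = 0 := fun a ha =>
    ((hAB a).mpr (Or.inl ha)).fderiv_eq_zero
  have hBcrit : ∀ b ∈ B, fderiv ℝ f b = 0 := fun b hb =>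
    ((hAB b).mpr (Or.inr hb)).fderiv_eq_zero
  set J : Set ℝ := {c | c < L ∧ ∃ a ∈ A, ∃ b ∈ B, JoinedIn {x | f x < c} a b} with hJ
  have hJne : J.Nonempty := by
    obtain ⟨a, ha⟩ := hA
    obtain ⟨b, hb⟩ := hB
    have : JoinedIn {x | f x < L} a b := by
      rw [show {x | f x < L} = univ from eq_univ_of_forall hL, joinedIn_univ]
      exact PathConnectedSpace.joined a b
    obtain ⟨c, hc, h⟩ := this.exists_lt_sublevel hfc
    exact ⟨c, hc, a, ha, b, hb, h⟩
  have hJbdd : BddBelow J := by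
    obtain ⟨l, hl⟩ := (hfin.image f).bddBelow
    refine ⟨l, fun c hc => ?_⟩
    obtain ⟨-, a, ha, b, -, h⟩ := hc
    exact (hl ⟨a, hAcrit a ha, rfl⟩).trans (h.source_mem : f a < c).le
  set c := sInf J with hc
  have hcL : c < L := by
    obtain ⟨c', hc'⟩ := hJne
    exact (csInf_le hJbdd hc').trans_lt hc'.1
  have hnot : ∀ a ∈ A, ∀ b ∈ B, ¬ JoinedIn {x | f x < c} a b := by
    intro a ha b hb h
    obtain ⟨c', hc', h'⟩ := h.exists_lt_sublevel hfc
    exact absurd (csInf_le hJbdd ⟨hc'.trans hcL, a, ha, b, hb, h'⟩) hc'.not_ge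
  have habove : ∀ c' > c, ∃ a ∈ A, ∃ b ∈ B, JoinedIn {x | f x < c'} a b := by
    intro c' hc'
    obtain ⟨c'', ⟨-, a, ha, b, hb, h⟩, hlt⟩ := exists_lt_of_csInf_lt hJne hc'
    exact ⟨a, ha, b, hb, h.mono fun x (hx : f x < c'') => hx.trans hlt⟩
  -- the parts of `{f < c}` leading to minima in `A` and in `B`
  have hopen : IsOpen {x | f x < c} := isOpen_lt hfc continuous_const
  have hVopen : ∀ S : Set E, IsOpen {x | ∃ a ∈ S, JoinedIn {y | f y < c} a x} := by
    intro S
    have : {x | ∃ a ∈ S, JoinedIn {y | f y < c} a x} =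
        ⋃ a ∈ S, pathComponentIn {y | f y < c} a := by
      ext x
      simp [pathComponentIn]
    rw [this]
    exact isOpen_biUnion fun a _ => hopen.pathComponentIn a
  set VA := {x | ∃ a ∈ A, JoinedIn {y | f y < c} a x} with hVA
  set VB := {x | ∃ b ∈ B, JoinedIn {y | f y < c} b x} with hVB
  have hVAB : ∀ x ∈ VA, x ∉ VB := by
    rintro x ⟨a, ha, hax⟩ ⟨b, hb, hbx⟩
    exact hnot a ha b hb (hax.trans hbx.symm)
  have hVcover : ∀ x, f x < c → x ∈ VA ∨ x ∈ VB := by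
    intro x hx
    obtain ⟨m, hm, hxm⟩ := exists_isLocalMin_joinedIn hfc (hcpt c hcL) hx
    rcases (hAB m).mp hm with h | h
    · exact Or.inl ⟨m, h, hxm.symm⟩
    · exact Or.inr ⟨m, h, hxm.symm⟩
  -- a common radius for the balls around the critical points
  have hrad : ∀ s ∈ {x | fderiv ℝ f x = 0}, ∀ᶠ r in 𝓝[>] (0 : ℝ), f s = c →
      (IsLocalMin f s → ∀ x ∈ Metric.ball s r, f s ≤ f x) ∧
      (¬ IsLocalMin f s → (∀ x ∈ Metric.ball s r, f x < c → x ∈ VA) ∨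
        (∀ x ∈ Metric.ball s r, f x < c → x ∈ VB)) := by
    intro s hs
    by_cases hmin : IsLocalMin f s
    · obtain ⟨r₀, hr₀, hball⟩ := Metric.eventually_nhds_iff_ball.mp hmin
      filter_upwards [Ioo_mem_nhdsGT hr₀] with r hr _
      exact ⟨fun _ x hx => hball x (Metric.ball_subset_ball hr.2.le hx), fun h => absurd hmin h⟩
    · obtain ⟨r₀, hr₀, hball⟩ := hsep s hs hmin
      filter_upwards [Ioo_mem_nhdsGT hr₀] with r hr hsc
      rw [hsc] at hball
      refine ⟨fun h => absurd h hmin, fun _ => hball.imp ?_ ?_⟩ <;>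
        exact fun h x hx => h x (Metric.ball_subset_ball hr.2.le hx)
  have hiso : ∀ s ∈ {x | fderiv ℝ f x = 0}, ∀ s' ∈ {x | fderiv ℝ f x = 0},
      ∀ᶠ r in 𝓝[>] (0 : ℝ), s ≠ s' → Disjoint (Metric.ball s r) (Metric.ball s' r) := by
    intro s _ s' _
    by_cases h : s = s'
    · exact Eventually.of_forall fun r h' => absurd h h'
    · filter_upwards [Ioo_mem_nhdsGT (show 0 < dist s s' / 2 by
        have := dist_pos.mpr h; positivity)] with r hr _
      exact Metric.ball_disjoint_ball (by linarith [hr.2])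
  obtain ⟨r, ⟨hrad, hiso⟩, hr⟩ := ((((eventually_all_finite hfin).mpr hrad).and
    ((eventually_all_finite hfin).mpr fun s hs =>
      (eventually_all_finite hfin).mpr (hiso s hs))).and self_mem_nhdsWithin).exists
  replace hr : 0 < r := hr
  -- the classes of critical points of level `c`, and the resulting separation
  set ZA := {s | fderiv ℝ f s = 0 ∧ f s = c ∧ s ∉ B ∧ ∀ x ∈ Metric.ball s r, f x < c → x ∈ VA}
    with hZA
  set ZB := {s | fderiv ℝ f s = 0 ∧ f s = c ∧ s ∉ ZA} with hZB
  have hZBA : ∀ s ∈ ZB, s ∉ A := by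
    rintro s ⟨hs0, hsc, hsZ⟩ hsA
    refine hsZ ⟨hs0, hsc, fun hsB => hdisj.ne_of_mem hsA hsB rfl, fun x hx hxc => ?_⟩
    have := (hrad s hs0 hsc).1 ((hAB s).mpr (Or.inl hsA)) x hx
    linarith
  have hZBV : ∀ s ∈ ZB, ∀ x ∈ Metric.ball s r, f x < c → x ∈ VB := by
    rintro s ⟨hs0, hsc, hsZ⟩ x hx hxc
    by_cases hmin : IsLocalMin f s
    · have := (hrad s hs0 hsc).1 hmin x hx
      linarith
    · rcases (hrad s hs0 hsc).2 hmin with h | h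
      · exact absurd ⟨hs0, hsc, fun hsB => hmin ((hAB s).mpr (Or.inr hsB)), h⟩ hsZ
      · exact h x hx hxc
  set OA := VA ∪ ⋃ s ∈ ZA, Metric.ball s r with hOA
  set OB := VB ∪ ⋃ s ∈ ZB, Metric.ball s r with hOB
  have hOAopen : IsOpen OA := (hVopen A).union (isOpen_biUnion fun _ _ => Metric.isOpen_ball)
  have hOBopen : IsOpen OB := (hVopen B).union (isOpen_biUnion fun _ _ => Metric.isOpen_ball)
  have hVlt : ∀ S : Set E, ∀ x, (∃ a ∈ S, JoinedIn {y | f y < c} a x) → f x < c :=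
    fun S x ⟨_, _, h⟩ => h.target_mem
  have hOdisj : ∀ x ∈ OA, x ∉ OB := by
    rintro x (hxA | hxA) (hxB | hxB)
    · exact hVAB x hxA hxB
    · obtain ⟨s, hs, hxs⟩ := mem_iUnion₂.mp hxB
      exact hVAB x hxA (hZBV s hs x hxs (hVlt A x hxA))
    · obtain ⟨s, hs, hxs⟩ := mem_iUnion₂.mp hxA
      exact hVAB x (hs.2.2.2 x hxs (hVlt B x hxB)) hxB
    · obtain ⟨s, hs, hxs⟩ := mem_iUnion₂.mp hxA
      obtain ⟨s', hs', hxs'⟩ := mem_iUnion₂.mp hxB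
      by_cases h : s = s'
      · exact hs'.2.2 (h ▸ hs)
      · exact disjoint_left.mp (hiso s hs.1 s' hs'.1 h) hxs hxs'
  set W := {x | f x < c} ∪ ⋃ s ∈ {s | fderiv ℝ f s = 0 ∧ f s = c}, Metric.ball s r with hW
  have hWopen : IsOpen W := hopen.union (isOpen_biUnion fun _ _ => Metric.isOpen_ball)
  have hWsub : W ⊆ OA ∪ OB := by
    rintro x (hx | hx)
    · exact (hVcover x hx).imp Or.inl Or.inl
    · obtain ⟨s, hs, hxs⟩ := mem_iUnion₂.mp hx
      by_cases hsZ : s ∈ ZA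
      · exact Or.inl (Or.inr (mem_iUnion₂.mpr ⟨s, hsZ, hxs⟩))
      · exact Or.inr (Or.inr (mem_iUnion₂.mpr ⟨s, ⟨hs.1, hs.2, hsZ⟩, hxs⟩))
  -- critical points lie in no ball but their own
  have hball : ∀ s z, fderiv ℝ f s = 0 → fderiv ℝ f z = 0 → z ∈ Metric.ball s r → s = z := by
    intro s z hs hz hzs
    by_contra h
    exact disjoint_left.mp (hiso s hs z hz h) hzs (Metric.mem_ball_self hr)
  have haO : ∀ a ∈ A, a ∈ W → a ∈ OA := by
    intro a ha haW
    rcases hWsub haW with h | h | h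
    · exact h
    · exact absurd h (hVAB a ⟨a, ha, JoinedIn.refl (hVlt B a h)⟩)
    · obtain ⟨s, hs, has⟩ := mem_iUnion₂.mp h
      exact absurd (hball s a hs.1 (hAcrit a ha) has ▸ ha) (hZBA s hs)
  have hbO : ∀ b ∈ B, b ∈ W → b ∈ OB := by
    intro b hb hbW
    rcases hWsub hbW with (h | h) | h
    · exact absurd ⟨b, hb, JoinedIn.refl (hVlt A b h)⟩ (hVAB b h)
    · obtain ⟨s, hs, hbs⟩ := mem_iUnion₂.mp h
      exact absurd (hball s b hs.1 (hBcrit b hb) hbs ▸ hb) hs.2.2.1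
    · exact h
  -- one descent step carries `{f < c'}` into `W` for some `c' > c`
  obtain ⟨c₁, hcc₁, hc₁L⟩ := exists_between hcL
  obtain ⟨φ, hφ, hφfix, hφlt⟩ := exists_descent_map hf (hcpt c₁ hc₁L)
  have hD : IsCompact ({x | f x ≤ c₁} \ φ ⁻¹' W) := (hcpt c₁ hc₁L).diff (hWopen.preimage hφ)
  have hDc : ∀ x ∈ {x | f x ≤ c₁} \ φ ⁻¹' W, c < f x := by
    rintro x ⟨hxK, hxW⟩
    by_contra! hxc
    by_cases h0 : fderiv ℝ f x = 0
    · rw [mem_preimage, hφfix x h0] at hxW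
      rcases hxc.lt_or_eq with h | h
      · exact hxW (Or.inl h)
      · exact hxW (Or.inr (mem_iUnion₂.mpr ⟨x, ⟨h0, h⟩, Metric.mem_ball_self hr⟩))
    · exact hxW (Or.inl ((hφlt x hxK h0).trans_le hxc))
  obtain ⟨c', hcc', hc'⟩ : ∃ c' > c, ∀ x, f x < c' → φ x ∈ W := by
    rcases ({x | f x ≤ c₁} \ φ ⁻¹' W).eq_empty_or_nonempty with he | hne
    · refine ⟨c₁, hcc₁, fun x hx => ?_⟩
      by_contra hxW
      have : x ∈ {x | f x ≤ c₁} \ φ ⁻¹' W := ⟨hx.le, hxW⟩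
      rw [he] at this
      exact this
    · obtain ⟨z, hz, hzmin⟩ := hD.exists_isMinOn hne hfc.continuousOn
      refine ⟨f z, hDc z hz, fun x hx => ?_⟩
      by_contra hxW
      exact absurd (hzmin ⟨hx.le.trans hz.1, hxW⟩) hx.not_ge
  obtain ⟨a, ha, b, hb, hab⟩ := habove c' hcc'
  have hab' : JoinedIn W a b := by
    have h := hab.map hφ
    rw [hφfix a (hAcrit a ha), hφfix b (hBcrit b hb)] at h
    exact h.mono (image_subset_iff.mpr hc')
  obtain ⟨γ, hγ⟩ := hab'
  obtain ⟨x, -, hxA, hxB⟩ := (isPreconnected_range γ.continuous) OA OB hOAopen hOBopen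
    ((range_subset_iff.mpr hγ).trans hWsub)
    ⟨a, ⟨0, γ.source⟩, haO a ha (γ.source ▸ hγ 0)⟩
    ⟨b, ⟨1, γ.target⟩, hbO b hb (γ.target ▸ hγ 1)⟩
  exact hOdisj x hxA hxB

/-- Near a nondegenerate critical point that is not a minimum, every point of the open sublevel set
below it is joined to one of two fixed minima. -/
theorem IsDescentInvolution.exists_two_minima {s : E} {R : E →L[ℝ] E} {ρ : ℝ}
    (h : IsDescentInvolution f s R ρ) (hf : Differentiable ℝ f)
    (hcpt : IsCompact {x | f x ≤ f s}) (hs : ¬ IsLocalMin f s) :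
    ∃ m₁ m₂, IsLocalMin f m₁ ∧ IsLocalMin f m₂ ∧ ∃ r > 0, ∀ x ∈ Metric.ball s r, f x < f s →
      JoinedIn {y | f y < f s} m₁ x ∨ JoinedIn {y | f y < f s} m₂ x := by
  obtain ⟨r, hr, hball⟩ := h.exists_joinedIn_or hf
  obtain ⟨x, hx, hxs⟩ : ∃ x ∈ Metric.ball s r, f x < f s := by
    by_contra! hall
    exact hs (Metric.eventually_nhds_iff_ball.mpr ⟨r, hr, hall⟩)
  obtain ⟨m₁, hm₁, hj₁⟩ := exists_isLocalMin_joinedIn hf.continuous hcpt hxs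
  by_cases hall : ∀ y ∈ Metric.ball s r, f y < f s → JoinedIn {z | f z < f s} x y
  · exact ⟨m₁, m₁, hm₁, hm₁, r, hr, fun y hy hys => Or.inl (hj₁.symm.trans (hall y hy hys))⟩
  · push Not at hall
    obtain ⟨y, hy, hys, hxy⟩ := hall
    obtain ⟨m₂, hm₂, hj₂⟩ := exists_isLocalMin_joinedIn hf.continuous hcpt hys
    refine ⟨m₁, m₂, hm₁, hm₂, r, hr, fun z hz hzs => ?_⟩
    rcases hball x hx y hy z hz hxs hys hzs with h | h | h
    · exact absurd h hxy
    · exact Or.inl (hj₁.symm.trans h)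
    · exact Or.inr (hj₂.symm.trans h)

/-- A weak Morse inequality: the number of minima exceeds the number of other critical points by at
most one. The minima are the vertices of a graph in which every other critical point contributes an
edge, joining the minima its two branches lead to; this graph is connected. -/
theorem ncard_isLocalMin_le (hf : ContDiff ℝ 2 f) {L : ℝ} (hL : ∀ x, f x < L)
    (hcpt : ∀ c < L, IsCompact {x | f x ≤ c}) (hfin : {x | fderiv ℝ f x = 0}.Finite)
    (hnd : ∀ s, fderiv ℝ f s = 0 → ∃ R ρ, IsDescentInvolution f s R ρ) :
    {x | IsLocalMin f x}.ncard ≤ {x | fderiv ℝ f x = 0 ∧ ¬ IsLocalMin f x}.ncard + 1 := by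
  have hfd : Differentiable ℝ f := hf.differentiable (by norm_num)
  set V := {x : E // IsLocalMin f x}
  set S := {x : E // fderiv ℝ f x = 0 ∧ ¬ IsLocalMin f x}
  have hVfin : Finite V := (hfin.subset fun x (hx : IsLocalMin f x) => hx.fderiv_eq_zero)
  have hSfin : Finite S := (hfin.subset fun x (hx : _ ∧ ¬ IsLocalMin f x) => hx.1)
  have hedge : ∀ s : S, ∃ m : V × V, ∃ r > 0, ∀ x ∈ Metric.ball s.1 r, f x < f s.1 →
      JoinedIn {y | f y < f s.1} m.1.1 x ∨ JoinedIn {y | f y < f s.1} m.2.1 x := by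
    rintro ⟨s, hs, hsmin⟩
    obtain ⟨R, ρ, h⟩ := hnd s hs
    obtain ⟨m₁, m₂, h₁, h₂, hr⟩ := h.exists_two_minima hfd (hcpt _ (hL s)) hsmin
    exact ⟨⟨⟨m₁, h₁⟩, ⟨m₂, h₂⟩⟩, hr⟩
  choose e he using hedge
  set G : SimpleGraph V := SimpleGraph.fromEdgeSet (range fun s => s((e s).1, (e s).2)) with hG
  have hreach : ∀ s, G.Reachable (e s).1 (e s).2 := by
    intro s
    by_cases h : (e s).1 = (e s).2
    · rw [h]
    · refine SimpleGraph.Adj.reachable ?_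
      rw [hG, SimpleGraph.fromEdgeSet_adj]
      exact ⟨⟨s, rfl⟩, h⟩
  have hconn : G.Connected := by
    have hne : Nonempty V := by
      obtain ⟨c, hc, hcL⟩ := exists_between (hL 0)
      obtain ⟨m, hm, -⟩ := exists_isLocalMin_joinedIn hf.continuous (hcpt c hcL) hc
      exact ⟨⟨m, hm⟩⟩
    rw [SimpleGraph.connected_iff]
    refine ⟨fun a b => ?_, hne⟩
    by_contra hab
    refine false_of_separated_minima hf hL hcpt hfin
      (A := {x | ∃ h : IsLocalMin f x, G.Reachable a ⟨x, h⟩})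
      (B := {x | ∃ h : IsLocalMin f x, ¬ G.Reachable a ⟨x, h⟩})
      ⟨a.1, a.2, SimpleGraph.Reachable.refl _⟩ ⟨b.1, b.2, hab⟩
      (disjoint_left.mpr fun x ⟨h, hx⟩ ⟨_, hx'⟩ => hx' hx) (fun x => ?_) (fun s hs hsmin => ?_)
    · by_cases h : IsLocalMin f x
      · simp [h, em]
      · simp [h]
    · obtain ⟨r, hr, hball⟩ := he ⟨s, hs, hsmin⟩
      have hre := hreach ⟨s, hs, hsmin⟩
      set m := e ⟨s, hs, hsmin⟩
      refine ⟨r, hr, ?_⟩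
      by_cases h : G.Reachable a m.1
      · left
        intro x hx hxs
        rcases hball x hx hxs with hj | hj
        · exact ⟨m.1.1, ⟨m.1.2, h⟩, hj⟩
        · exact ⟨m.2.1, ⟨m.2.2, h.trans hre⟩, hj⟩
      · right
        intro x hx hxs
        rcases hball x hx hxs with hj | hj
        · exact ⟨m.1.1, ⟨m.1.2, h⟩, hj⟩
        · exact ⟨m.2.1, ⟨m.2.2, fun h' => h (h'.trans hre.symm)⟩, hj⟩
  have hcard : Nat.card G.edgeSet ≤ Nat.card S := by
    rw [Nat.card_coe_set_eq, hG, SimpleGraph.edgeSet_fromEdgeSet]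
    calc _ ≤ (range fun s => s((e s).1, (e s).2)).ncard :=
          ncard_le_ncard sdiff_subset (finite_range _)
      _ ≤ Nat.card S := by
          rw [← image_univ, ← ncard_univ]
          exact ncard_image_le finite_univ
  exact hconn.card_vert_le_card_edgeSet_add_one.trans (Nat.add_le_add_right hcard 1)

end Counting

/-! ### Positive combinations of Gaussian functions -/

section GaussianSums

variable {E : Type*} [NormedAddCommGroup E] [NormedSpace ℝ E] {ι : Type*} [Fintype ι]

/-- A combination of Gaussian functions `exp (-B (x - μ) (x - μ) / 2)` with coefficients `c i`,
centres `μ i` and bilinear forms `B i`. -/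
noncomputable def gaussianSum (c : ι → ℝ) (μ : ι → E) (B : ι → E →L[ℝ] E →L[ℝ] ℝ) (x : E) : ℝ :=
  ∑ i, c i * Real.exp (-(1 / 2) * B i (x - μ i) (x - μ i))

variable {c : ι → ℝ} {μ : ι → E} {B : ι → E →L[ℝ] E →L[ℝ] ℝ}

theorem contDiff_gaussianSum {n : WithTop ℕ∞} : ContDiff ℝ n (gaussianSum c μ B) := by
  refine ContDiff.sum fun i _ => contDiff_const.mul (Real.contDiff_exp.comp (contDiff_const.mul ?_))
  exact ((B i).contDiff.comp (contDiff_id.sub contDiff_const)).clm_apply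
    (contDiff_id.sub contDiff_const)

theorem gaussianSum_pos [Nonempty ι] (hc : ∀ i, 0 < c i) (x : E) : 0 < gaussianSum c μ B x :=
  Finset.sum_pos (fun i _ => mul_pos (hc i) (Real.exp_pos _)) Finset.univ_nonempty

theorem fderiv_gaussianSum_apply (x v : E) : fderiv ℝ (gaussianSum c μ B) x v =
    ∑ i, c i * (Real.exp (-(1 / 2) * B i (x - μ i) (x - μ i)) *
      (-(1 / 2) * (B i (x - μ i) v + B i v (x - μ i)))) := by
  have hsub : ∀ i, HasFDerivAt (fun y : E => y - μ i) (ContinuousLinearMap.id ℝ E) x :=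
    fun i => (hasFDerivAt_id x).sub_const _
  have h : HasFDerivAt (gaussianSum c μ B) _ x :=
    HasFDerivAt.fun_sum fun i (_ : i ∈ Finset.univ) =>
      ((((B i).hasFDerivAt_of_bilinear (hsub i) (hsub i)).const_mul (-(1 / 2) : ℝ)).exp).const_mul
        (c i)
  rw [h.fderiv]
  simp only [sum_apply, smul_apply, add_apply, smul_eq_mul, ContinuousLinearMap.precompR_apply,
    ContinuousLinearMap.precompL_apply, ContinuousLinearMap.id_apply]
  rfl

variable [FiniteDimensional ℝ E]

theorem tendsto_gaussianSum_cocompact (hB : ∀ i x, x ≠ 0 → 0 < B i x x) :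
    Tendsto (gaussianSum c μ B) (cocompact E) (𝓝 0) := by
  rw [show (0 : ℝ) = ∑ i : ι, c i * 0 by simp]
  refine tendsto_finsetSum _ fun i _ => Tendsto.const_mul _ ?_
  refine Real.tendsto_exp_atBot.comp (Tendsto.const_mul_atTop_of_neg (by norm_num) ?_)
  obtain ⟨m, hm, hmB⟩ := exists_pos_mul_sq_norm_le (B i) (hB i)
  refine tendsto_atTop_mono (fun x => hmB (x - μ i)) (Tendsto.const_mul_atTop hm
    ((tendsto_pow_atTop two_ne_zero).comp ?_))
  refine tendsto_atTop_mono (fun x => norm_sub_norm_le x (μ i)) ?_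
  exact tendsto_atTop_add_const_right _ _ tendsto_norm_cocompact_atTop

theorem isCompact_le_gaussianSum (hB : ∀ i x, x ≠ 0 → 0 < B i x x) {a : ℝ} (ha : 0 < a) :
    IsCompact {x | a ≤ gaussianSum c μ B x} := by
  have h := (tendsto_gaussianSum_cocompact (c := c) (μ := μ) hB).eventually_lt_const ha
  obtain ⟨K, hK, hsub⟩ := mem_cocompact.mp h
  refine hK.of_isClosed_subset
    (isClosed_le continuous_const (contDiff_gaussianSum (n := 0)).continuous) fun x hx => ?_
  by_contra hxK
  exact not_lt_of_ge (α := ℝ) hx (hsub hxK)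

/-- The critical set is bounded because, far from the origin, a positive combination of Gaussian
functions has negative radial derivative. -/
theorem isCompact_critical_gaussianSum [Nonempty ι] (hc : ∀ i, 0 < c i)
    (hB : ∀ i x, x ≠ 0 → 0 < B i x x) :
    IsCompact {x | fderiv ℝ (gaussianSum c μ B) x = 0} := by
  have hev : ∀ᶠ x in cocompact E, ∀ i, 0 < B i (x - μ i) x + B i x (x - μ i) := by
    rw [eventually_all]
    intro i
    obtain ⟨m, hm, hmB⟩ := exists_pos_mul_sq_norm_le (B i) (hB i)
    filter_upwards [tendsto_norm_cocompact_atTop.eventually_gt_atTop (‖B i‖ * ‖μ i‖ / m)]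
      with x hx
    have hx0 : 0 < ‖x‖ := lt_of_le_of_lt (by positivity) hx
    rw [div_lt_iff₀ hm] at hx
    have h1 : B i (μ i) x ≤ ‖B i‖ * ‖μ i‖ * ‖x‖ :=
      (le_abs_self _).trans ((B i).le_opNorm₂ (μ i) x)
    have h2 : B i x (μ i) ≤ ‖B i‖ * ‖x‖ * ‖μ i‖ :=
      (le_abs_self _).trans ((B i).le_opNorm₂ x (μ i))
    have h3 := hmB x
    have h4 : ‖B i‖ * ‖μ i‖ * ‖x‖ < ‖x‖ * m * ‖x‖ := by gcongr
    simp only [map_sub, sub_apply]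
    nlinarith
  obtain ⟨K, hK, hsub⟩ := mem_cocompact.mp hev
  refine hK.of_isClosed_subset (isClosed_eq
    ((contDiff_gaussianSum (n := 1)).continuous_fderiv (by norm_num)) continuous_const)
    fun x hx => ?_
  by_contra hxK
  have hpos := hsub hxK
  have hzero : fderiv ℝ (gaussianSum c μ B) x x = 0 := by rw [hx]; rfl
  rw [fderiv_gaussianSum_apply] at hzero
  refine (Finset.sum_neg (fun i _ => ?_) Finset.univ_nonempty).ne hzero
  exact mul_neg_of_pos_of_neg (hc i) (mul_neg_of_pos_of_neg (Real.exp_pos _)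
    (mul_neg_of_neg_of_pos (by norm_num) (hpos i)))

end GaussianSums

/-! ### Finiteness of the critical set -/

/-- A nondegenerate critical point is isolated, since `f` has a nonzero directional derivative at
all other nearby points. -/
theorem finite_critical_of_isDescentInvolution {E : Type*} [NormedAddCommGroup E]
    [NormedSpace ℝ E] {f : E → ℝ} (hK : IsCompact {x | fderiv ℝ f x = 0})
    (hnd : ∀ s, fderiv ℝ f s = 0 → ∃ R ρ, IsDescentInvolution f s R ρ) :
    {x | fderiv ℝ f x = 0}.Finite := by
  by_contra hinf
  obtain ⟨z, hz, hacc⟩ := Set.Infinite.exists_accPt_of_subset_isCompact hinf hK subset_rfl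
  obtain ⟨R, ρ, h⟩ := hnd z hz
  rw [accPt_iff_frequently] at hacc
  refine hacc ?_
  filter_upwards [Metric.closedBall_mem_nhds z h.radius_pos] with x hx ⟨hxz, hx0⟩
  exact h.fderiv_ne_zero hxz (by rwa [mem_closedBall_iff_norm] at hx) hx0

/-! ### Gaussian mixture densities -/

section Mixture

variable {d : ℕ}

theorem IsGaussianMixtureDensity.exists_eq_gaussianSum {h : EuclideanSpace ℝ (Fin d) → ℝ}
    (hmix : IsGaussianMixtureDensity h) :
    ∃ (k : ℕ) (_ : Nonempty (Fin k)) (c : Fin k → ℝ) (μ : Fin k → EuclideanSpace ℝ (Fin d))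
      (B : Fin k → EuclideanSpace ℝ (Fin d) →L[ℝ] EuclideanSpace ℝ (Fin d) →L[ℝ] ℝ),
      (∀ i, 0 < c i) ∧ (∀ i x, x ≠ 0 → 0 < B i x x) ∧ h = gaussianSum c μ B := by
  obtain ⟨k, α, μ, S, hα, hsum, hS, hh⟩ := hmix
  have hk : Nonempty (Fin k) := by
    by_contra hempty
    rw [not_nonempty_iff] at hempty
    simp at hsum
  have hB : ∀ i x, ((innerSL ℝ).comp (Matrix.toEuclideanCLM (𝕜 := ℝ) (S i)⁻¹)) x x =
      x.ofLp ⬝ᵥ ((S i)⁻¹ *ᵥ x.ofLp) := by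
    intro i x
    simp [EuclideanSpace.inner_eq_star_dotProduct]
  refine ⟨k, hk, fun i => α i * (1 / ((2 * Real.pi) ^ ((d : ℝ) / 2) * Real.sqrt (S i).det)), μ,
    fun i => (innerSL ℝ).comp (Matrix.toEuclideanCLM (𝕜 := ℝ) (S i)⁻¹), fun i => ?_,
    fun i x hx => ?_, ?_⟩
  · have := (hS i).det_pos
    have := hα i
    positivity
  · rw [hB]
    simpa using (hS i).inv.dotProduct_mulVec_pos (x := x.ofLp) (by simpa using hx)
  · funext x
    rw [hh, gaussianSum]
    refine Finset.sum_congr rfl fun i _ => ?_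
    rw [hB, gaussianDensity, mul_assoc]

theorem eq_zero_of_hessianMatrix_det_ne_zero {h : EuclideanSpace ℝ (Fin d) → ℝ}
    {s : EuclideanSpace ℝ (Fin d)} (hdet : (hessianMatrix h s).det ≠ 0)
    {x : EuclideanSpace ℝ (Fin d)} (hx : ∀ y, fderiv ℝ (fderiv ℝ h) s x y = 0) : x = 0 := by
  have hv : x.ofLp ᵥ* hessianMatrix h s = 0 := by
    funext j
    have hxs : x = ∑ i, x i • EuclideanSpace.single i (1 : ℝ) := by
      simpa using ((EuclideanSpace.basisFun (Fin d) ℝ).sum_repr x).symm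
    have h0 := hx (EuclideanSpace.single j 1)
    rw [hxs, map_sum, sum_apply] at h0
    simpa [Matrix.vecMul, dotProduct, hessianMatrix] using h0
  simpa using Matrix.eq_zero_of_vecMul_eq_zero hdet hv

theorem criticalSet_eq (h : EuclideanSpace ℝ (Fin d) → ℝ) :
    criticalSet h = {x | fderiv ℝ (fun y => -h y) x = 0} := by
  ext x
  simp [criticalSet, gradient, fderiv_fun_neg]

theorem modalSet_eq (h : EuclideanSpace ℝ (Fin d) → ℝ) :
    modalSet h = {x | IsLocalMin (fun y => -h y) x} := by
  ext x
  simp [modalSet, IsLocalMin, IsMinFilter, Metric.eventually_nhds_iff, dist_eq_norm]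

end Mixture

theorem mainTheorem4 (d : ℕ) (hd : 1 ≤ d) (h : EuclideanSpace ℝ (Fin d) → ℝ)
    (hmix : IsGaussianMixtureDensity h)
    (hmorse : ∀ x ∈ criticalSet h, (hessianMatrix h x).det ≠ 0) :
    (criticalSet h).Finite ∧
      (modalSet h).ncard ≤ ((criticalSet h).ncard + 1) / 2 := by
  obtain ⟨k, hk, c, μ, B, hc, hB, hh⟩ := hmix.exists_eq_gaussianSum
  have hC : ContDiff ℝ 2 h := hh ▸ contDiff_gaussianSum
  set f : EuclideanSpace ℝ (Fin d) → ℝ := fun y => -h y with hf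
  have hfC : ContDiff ℝ 2 f := hC.neg
  have hfd : fderiv ℝ f = fun x => -fderiv ℝ h x := funext fun x => fderiv_fun_neg
  have hcrit : criticalSet h = {x | fderiv ℝ f x = 0} := criticalSet_eq h
  have hmode : modalSet h = {x | IsLocalMin f x} := modalSet_eq h
  have hnd : ∀ s, fderiv ℝ f s = 0 → ∃ R ρ, IsDescentInvolution f s R ρ := by
    intro s hs
    refine exists_isDescentInvolution hfC hs fun x hx => ?_
    refine eq_zero_of_hessianMatrix_det_ne_zero (hmorse s (hcrit ▸ hs)) fun y => ?_
    have := hx y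
    rw [hfd, fderiv_fun_neg] at this
    simpa using this
  have hfin : {x | fderiv ℝ f x = 0}.Finite := by
    refine finite_critical_of_isDescentInvolution ?_ hnd
    have := isCompact_critical_gaussianSum (μ := μ) hc hB
    simpa [hfd, hh] using this
  have hle := ncard_isLocalMin_le hfC (L := 0)
    (fun x => by simpa [hf, hh] using gaussianSum_pos (μ := μ) (B := B) hc x)
    (fun a ha => by
      have := isCompact_le_gaussianSum (c := c) (μ := μ) hB (neg_pos.mpr ha)
      simpa [hf, hh, neg_le] using this) hfin hnd
  have hsum : {x | fderiv ℝ f x = 0 ∧ ¬ IsLocalMin f x}.ncard + {x | IsLocalMin f x}.ncard =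
      {x | fderiv ℝ f x = 0}.ncard :=
    ncard_sdiff_add_ncard_of_subset (s := {x | IsLocalMin f x})
      (fun x (hx : IsLocalMin f x) => hx.fderiv_eq_zero) hfin
  rw [hcrit, hmode]
  exact ⟨hfin, by omega⟩
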